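/- An $r$-uniform graph ($r$-graph) $G$ consists of a finite vertex set $V(G)$ and a set $E(G)$ of $r$-element subsets of $V(G)$; its density is $d(G)=|E(G)|/\binom{|V(G)|}{r}$. A real number $\alpha\in[0,1)$ is a jump for $r$ if there is a constant $c>0$ such that for every $\varepsilon>0$ and every integer $m\ge r$ there is an integer $n_0$ such that every $r$-graph with $n>n_0$ vertices and density at least $\alpha+\varepsilon$ contains a subgraph with $m$ vertices and density at least $\alpha+c$; otherwise $\alpha\in[0,1)$ is a non-jump for $r$. The Lagrangian of an $r$-graph $G$ on $[n]=\{1,\dots,n\}$, $n\ge 1$, is $\lambda(G)=\max\big\{\sum_{e\in E(G)}\prod_{i\in e}x_i : x_1,\dots,x_n\ge 0,\ \sum_{i=1}^n x_i=1\big\}$. Theorem. For every integer $k\ge 2$ the number $$\alpha_k=\frac{2k-6k^3+4k^4-k\sqrt{4k-1}+4k^2\sqrt{4k-1}}{(2k^2+1)^2}$$ lies in $[0,1)$, is not a jump for $r=3$, and is irrational. Moreover $\alpha_k=6\lim_{n\to\infty}\lambda(B(2k,n))$, where $B(2k,n)$ is the $3$-graph with vertex set $[n]$ whose edges are the triples $e\subseteq[n]$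 with $e\cap[2k]\neq\emptyset$. In particular there are infinitely many irrational non-jumps for $r=3$. -/

import Mathlib

/-- An `r`-uniform graph with vertex set `V`: a set of `r`-element subsets of `V`. -/
structure RGraph (r : ℕ) (V : Type*) where
  /-- the edge set -/
  edges : Finset (Finset V)
  /-- every edge has exactly `r` vertices -/
  card_edge : ∀ e ∈ edges, e.card = r

namespace RGraph

/-- The density `|E(G)| / (|V(G)| choose r)`. -/
noncomputable def density {r : ℕ} {V : Type*} [Fintype V] (G : RGraph r V) : ℝ :=
  (G.edges.card : ℝ) / ((Fintype.card V).choose r : ℝ)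

/-- `G` contains (an isomorphic copy of) `H` as a subgraph, not necessarily induced. -/
def Contains {r : ℕ} {V W : Type*} (G : RGraph r V) (H : RGraph r W) : Prop :=
  ∃ f : W ↪ V, ∀ e ∈ H.edges, e.map f ∈ G.edges

/-- The Lagrangian function `λ(G, x) = ∑_{e ∈ E(G)} ∏_{i ∈ e} x_i`. -/
def lagrangianFun {r : ℕ} {V : Type*} (G : RGraph r V) (x : V → ℝ) : ℝ :=
  ∑ e ∈ G.edges, ∏ i ∈ e, x i

/-- The Lagrangian `λ(G)`: the maximum of `λ(G, x)` over the weight vectors `x ≥ 0` of total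
weight `1`. The maximum is attained as soon as there is a vertex, see `isGreatest_lagrangian`. -/
noncomputable def lagrangian {r : ℕ} {V : Type*} [Fintype V] (G : RGraph r V) : ℝ :=
  sSup (G.lagrangianFun '' stdSimplex ℝ V)

theorem isGreatest_lagrangian {r : ℕ} {V : Type*} [Fintype V] [Nonempty V] (G : RGraph r V) :
    IsGreatest (G.lagrangianFun '' stdSimplex ℝ V) G.lagrangian := by
  classical
  have hc : Continuous G.lagrangianFun := by
    unfold lagrangianFun
    fun_prop
  have hne : (stdSimplex ℝ V).Nonempty :=
    ⟨_, single_mem_stdSimplex ℝ (Classical.arbitrary V)⟩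
  exact ((isCompact_stdSimplex ℝ V).image hc).isGreatest_sSup (hne.image _)

end RGraph

/-- The defining property of a jump `α` for `r` (for real numbers `α ∈ [0, 1)`): there is `c > 0`
such that for all `ε > 0` and `m ≥ r`, every sufficiently large `r`-graph of density at least
`α + ε` contains a subgraph with `m` vertices and density at least `α + c`. -/
def IsJump (r : ℕ) (α : ℝ) : Prop :=
  ∃ c : ℝ, 0 < c ∧ ∀ ε : ℝ, 0 < ε → ∀ m : ℕ, r ≤ m → ∃ n₀ : ℕ,
    ∀ (V : Type) [Fintype V] (G : RGraph r V), n₀ < Fintype.card V → α + ε ≤ G.density →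
      ∃ H : RGraph r (Fin m), G.Contains H ∧ α + c ≤ H.density

/-- The 3-graph on `n` vertices whose edges are all the triples that meet the set of
the first `s` vertices. -/
def meetGraph (s n : ℕ) : RGraph 3 (Fin n) where
  edges := (Finset.powersetCard 3 Finset.univ).filter fun e => ∃ i ∈ e, i.val < s
  card_edge := fun _ he => (Finset.mem_powersetCard.mp (Finset.mem_filter.mp he).1).2

/-- The number `α_k`. -/
noncomputable def alphaK (k : ℕ) : ℝ :=
  (2 * (k : ℝ) - 6 * (k : ℝ) ^ 3 + 4 * (k : ℝ) ^ 4 - (k : ℝ) * Real.sqrt (4 * (k : ℝ) - 1)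
      + 4 * (k : ℝ) ^ 2 * Real.sqrt (4 * (k : ℝ) - 1)) / (2 * (k : ℝ) ^ 2 + 1) ^ 2

/-! The proof is the Frankl–Rödl method applied to the triples meeting a core `C` of size `2k`. If
`C` carries weight `X`, evenly shared, and the rest is spread over `t` outside vertices, six times
the Lagrangian function is `meetPoly (1 / (2k)) X - 3X(1 - X)²/t`. The maximum of the cubic is
`α_k`, so the limit is `α_k` and every finite graph misses it by at most `O(1/t)`.

The deficit is overcome by adding `σt²` triples outside `C`, with `σ` large: they contribute `6σ(1 -
X)³/t`, and the Lagrangian exceeds `α_k` (`exists_meetAddGraph_lt`). The deletion method yields such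
triples so sparse that any `v` vertices, `2 ≤ v ≤ m`, span at most `v - 2` of them
(`exists_sparseTriples`). A weight vector supported on `m` vertices then still gives at most `α_k`
(`lagrangianFun_meetAddGraph_le`): by Hall's theorem the added triples count no more than if they
all shared the two heaviest outside vertices, and `meetPoly_add_le` handles that case.

Blow-ups of the enlarged graph thus have density bounded below by some `β > α_k`, while their
`m`-vertex subgraphs have at most `α_k m³/6` edges. For large `m` this rules out density `α_k + c`.

Irrationality holds because `4k - 1 ≡ 3 (mod 4)` is not a square; infinitude because `α_k` is
strictly increasing. -/

namespace RGraph

/-! ### Blow-ups and the Lagrangian -/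

variable {r : ℕ} {V W : Type*}

open Classical in
/-- The pullback of `G` along `π : W → V`: the `r`-sets of `W` that `π` maps onto edges of `G`.
If all the fibres are non-empty this is a blow-up of `G`. -/
noncomputable def pullback [Fintype W] (G : RGraph r V) (π : W → V) : RGraph r W where
  edges := Finset.univ.filter fun e => e.card = r ∧ e.image π ∈ G.edges
  card_edge := fun _ he => (Finset.mem_filter.mp he).2.1

open Classical in
-- The sets counted are the transversals of the fibres over `e`: equal cardinality forces `π` to be
-- injective on `e'`.
theorem card_filter_image_eq [Fintype W] (π : W → V) (e : Finset V) :
    (Finset.univ.filter fun e' : Finset W => e'.card = e.card ∧ e'.image π = e).card =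
      ∏ v ∈ e, (Finset.univ.filter fun w => π w = v).card := by
  rw [← Finset.card_pi]
  symm
  refine Finset.card_bij (fun p _ => e.attach.image fun v => p v.1 v.2) ?_ ?_ ?_
  · intro p hp
    have hp' : ∀ v (hv : v ∈ e), π (p v hv) = v := fun v hv => by
      simpa using Finset.mem_pi.mp hp v hv
    have himg : (e.attach.image fun v => p v.1 v.2).image π = e := by
      ext v
      simp only [Finset.mem_image, Finset.mem_attach, true_and, Subtype.exists]
      constructor
      · rintro ⟨_, ⟨u, hu, rfl⟩, rfl⟩
        rwa [hp' u hu]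
      · intro hv
        exact ⟨_, ⟨v, hv, rfl⟩, hp' v hv⟩
    refine Finset.mem_filter.mpr ⟨Finset.mem_univ _, ?_, himg⟩
    refine le_antisymm (Finset.card_image_le.trans (by simp)) ?_
    conv_lhs => rw [← himg]
    exact Finset.card_image_le
  · intro p hp p' hp' h
    have h1 : ∀ v (hv : v ∈ e), π (p v hv) = v := fun v hv => by
      simpa using Finset.mem_pi.mp hp v hv
    have h2 : ∀ v (hv : v ∈ e), π (p' v hv) = v := fun v hv => by
      simpa using Finset.mem_pi.mp hp' v hv
    funext v hv
    have : p v hv ∈ e.attach.image fun v => p' v.1 v.2 := by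
      rw [← h]
      exact Finset.mem_image.mpr ⟨⟨v, hv⟩, Finset.mem_attach _ _, rfl⟩
    obtain ⟨⟨u, hu⟩, -, huv⟩ := Finset.mem_image.mp this
    have : u = v := by rw [← h2 u hu, ← h1 v hv]; exact congrArg π huv
    subst this
    exact huv.symm
  · intro e' he'
    obtain ⟨-, hcard, himg⟩ := Finset.mem_filter.mp he'
    have hinj : Set.InjOn π e' := by
      rw [← Finset.card_image_iff, himg, hcard]
    have hex : ∀ v ∈ e, ∃ w ∈ e', π w = v := fun v hv => by
      rw [← himg] at hv
      simpa using hv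
    choose p hp hpv using hex
    refine ⟨p, Finset.mem_pi.mpr fun v hv => by simpa using hpv v hv, ?_⟩
    ext w
    simp only [Finset.mem_image, Finset.mem_attach, true_and, Subtype.exists]
    constructor
    · rintro ⟨v, hv, rfl⟩
      exact hp v hv
    · intro hw
      have hv : π w ∈ e := himg ▸ Finset.mem_image_of_mem π hw
      exact ⟨π w, hv, hinj (hp _ hv) hw (hpv _ hv)⟩

open Classical in
theorem card_edges_pullback [Fintype W] (G : RGraph r V) (π : W → V) :
    ((G.pullback π).edges.card : ℝ) =
      G.lagrangianFun fun v => ((Finset.univ.filter fun w => π w = v).card : ℝ) := by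
  have h : (G.pullback π).edges = G.edges.biUnion fun e =>
      Finset.univ.filter fun e' : Finset W => e'.card = e.card ∧ e'.image π = e := by
    ext e'
    simp only [pullback, Finset.mem_filter, Finset.mem_univ, true_and, Finset.mem_biUnion]
    constructor
    · rintro ⟨h1, h2⟩
      exact ⟨_, h2, by rw [h1, G.card_edge _ h2], rfl⟩
    · rintro ⟨e, he, h1, rfl⟩
      exact ⟨by rw [h1, G.card_edge _ he], he⟩
  rw [h, Finset.card_biUnion]
  · simp only [card_filter_image_eq, lagrangianFun]
    push_cast
    rfl
  · intro e _ e₂ _ hne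
    refine Finset.disjoint_left.mpr ?_
    intro e' h1 h2
    exact hne ((Finset.mem_filter.mp h1).2.2.symm.trans (Finset.mem_filter.mp h2).2.2)

theorem lagrangianFun_mul (G : RGraph r V) (c : ℝ) (x : V → ℝ) :
    G.lagrangianFun (fun v => c * x v) = c ^ r * G.lagrangianFun x := by
  unfold lagrangianFun
  rw [Finset.mul_sum]
  refine Finset.sum_congr rfl fun e he => ?_
  rw [Finset.prod_mul_distrib, Finset.prod_const, G.card_edge e he]

theorem continuous_lagrangianFun (G : RGraph r V) : Continuous G.lagrangianFun := by
  unfold lagrangianFun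
  fun_prop

/-- An `m`-vertex subgraph of a pullback of `G` gives a weight vector on `G`, supported on at most
`m` vertices, with a large value of the Lagrangian function. -/
theorem exists_weight_of_contains_pullback [Fintype V] [Fintype W] (G : RGraph r V) (π : W → V)
    {m : ℕ} (hm : 0 < m) (H : RGraph r (Fin m)) (h : (G.pullback π).Contains H) :
    ∃ z ∈ stdSimplex ℝ V, ∃ S : Finset V, S.card ≤ m ∧ (∀ v, v ∉ S → z v = 0) ∧
      (H.edges.card : ℝ) ≤ (m : ℝ) ^ r * G.lagrangianFun z := by
  classical
  obtain ⟨f, hf⟩ := h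
  have hm' : (m : ℝ) ≠ 0 := by positivity
  set φ : Fin m → V := fun i => π (f i)
  set n : V → ℝ := fun v => ((Finset.univ.filter fun w => φ w = v).card : ℝ) with hn
  have hsum : ∑ v, n v = m := by
    have := Finset.card_eq_sum_card_fiberwise (f := φ) (s := Finset.univ) (t := Finset.univ)
      (fun _ _ => by simp)
    simp only [Finset.card_univ, Fintype.card_fin] at this
    simp only [hn]
    exact_mod_cast this.symm
  refine ⟨fun v => (m : ℝ)⁻¹ * n v, ⟨fun v => by positivity, ?_⟩, Finset.univ.image φ, ?_, ?_, ?_⟩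
  · rw [← Finset.mul_sum, hsum, inv_mul_cancel₀ hm']
  · exact Finset.card_image_le.trans (by simp)
  · intro v hv
    have : (Finset.univ.filter fun w => φ w = v) = ∅ := by
      rw [Finset.filter_eq_empty_iff]
      rintro w - rfl
      exact hv (Finset.mem_image_of_mem _ (Finset.mem_univ _))
    simp [hn, this]
  · rw [lagrangianFun_mul, ← mul_assoc, ← mul_pow, mul_inv_cancel₀ hm', one_pow, one_mul,
      hn, ← card_edges_pullback]
    refine Nat.cast_le.mpr (Finset.card_le_card fun e he => ?_)
    refine Finset.mem_filter.mpr ⟨Finset.mem_univ _, H.card_edge e he, ?_⟩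
    have := (Finset.mem_filter.mp (hf e he)).2.2
    rwa [Finset.map_eq_image, Finset.image_image] at this

/-- Blow-ups of `G` have arbitrarily many vertices and density close to `r!` times any value of the
Lagrangian function on the standard simplex. -/
theorem exists_pullback_density {V : Type} [Fintype V] (G : RGraph 3 V) {w : V → ℝ}
    (hw : w ∈ stdSimplex ℝ V) {β : ℝ} (hβ : β < 6 * G.lagrangianFun w) (n₀ : ℕ) :
    ∃ (W : Type) (_ : Fintype W) (π : W → V), n₀ < Fintype.card W ∧
      β ≤ (G.pullback π).density := by
  classical
  have htend : Filter.Tendsto (fun N : ℕ => 6 * G.lagrangianFun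
      fun v => (⌊w v * N⌋₊ : ℝ) / N) Filter.atTop (nhds (6 * G.lagrangianFun w)) := by
    refine Filter.Tendsto.const_mul _ ((G.continuous_lagrangianFun.tendsto w).comp ?_)
    rw [tendsto_pi_nhds]
    intro v
    exact (tendsto_nat_floor_mul_div_atTop (hw.1 v)).comp tendsto_natCast_atTop_atTop
  obtain ⟨N, hN, hNn⟩ := ((htend.eventually (lt_mem_nhds hβ)).and
    -- Rounding down loses at most one vertex per fibre; the 3 keeps the binomial coefficient in the
    -- density positive.
    (Filter.eventually_gt_atTop (n₀ + Fintype.card V + 3))).exists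
  refine ⟨(v : V) × Fin ⌊w v * N⌋₊, inferInstance, Sigma.fst, ?_, ?_⟩
  all_goals
    have hcard : Fintype.card ((v : V) × Fin ⌊w v * N⌋₊) = ∑ v, ⌊w v * N⌋₊ := by simp
    have hlow : (N : ℝ) ≤ (∑ v, ⌊w v * N⌋₊ : ℕ) + Fintype.card V := by
      calc (N : ℝ) = ∑ v, w v * N := by rw [← Finset.sum_mul, hw.2, one_mul]
        _ ≤ ∑ v, ((⌊w v * N⌋₊ : ℝ) + 1) :=
          Finset.sum_le_sum fun v _ => (Nat.lt_floor_add_one _).le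
        _ = _ := by simp [Finset.sum_add_distrib]
    have hlow' : N ≤ (∑ v, ⌊w v * N⌋₊) + Fintype.card V := by exact_mod_cast hlow
  · rw [hcard]; omega
  · have hup : ((∑ v, ⌊w v * N⌋₊ : ℕ) : ℝ) ≤ N := by
      calc ((∑ v, ⌊w v * N⌋₊ : ℕ) : ℝ) = ∑ v, (⌊w v * N⌋₊ : ℝ) := by push_cast; rfl
        _ ≤ ∑ v, w v * N := Finset.sum_le_sum fun v _ =>
          Nat.floor_le (mul_nonneg (hw.1 v) (Nat.cast_nonneg _))
        _ = N := by rw [← Finset.sum_mul, hw.2, one_mul]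
    have hN0 : (0 : ℝ) < N := by exact_mod_cast (by omega : 0 < N)
    have hfib : ∀ v, (Finset.univ.filter fun x : (v : V) × Fin ⌊w v * N⌋₊ => x.1 = v).card
        = ⌊w v * N⌋₊ := by
      intro v
      have : (Finset.univ.filter fun x : (v : V) × Fin ⌊w v * N⌋₊ => x.1 = v) =
          Finset.univ.map (Function.Embedding.sigmaMk v) := by
        ext ⟨u, i⟩
        simp only [Finset.mem_filter, Finset.mem_univ, true_and, Finset.mem_map,
          Function.Embedding.sigmaMk_apply]
        constructor
        · rintro rfl
          exact ⟨i, rfl⟩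
        · rintro ⟨j, hj⟩
          exact (congrArg Sigma.fst hj).symm
      rw [this, Finset.card_map, Finset.card_univ, Fintype.card_fin]
    have hedges : N ^ 3 * G.lagrangianFun (fun v => (⌊w v * N⌋₊ : ℝ) / N) =
        (G.pullback (Sigma.fst : (v : V) × Fin ⌊w v * N⌋₊ → V)).edges.card := by
      rw [card_edges_pullback, ← lagrangianFun_mul]
      simp only [hfib, mul_div_cancel₀ _ hN0.ne']
    have hchoose : (((∑ v, ⌊w v * N⌋₊).choose 3 : ℕ) : ℝ) ≤ N ^ 3 / 6 := by
      refine (Nat.choose_le_pow_div 3 _).trans ?_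
      simp only [Nat.factorial]
      norm_num
      gcongr
      exact_mod_cast hup
    have hpos : (0 : ℝ) < ((∑ v, ⌊w v * N⌋₊).choose 3 : ℕ) := by
      exact_mod_cast Nat.choose_pos (by omega)
    have hnonneg : 0 ≤ G.lagrangianFun (fun v => (⌊w v * N⌋₊ : ℝ) / N) :=
      Finset.sum_nonneg fun _ _ => Finset.prod_nonneg fun _ _ => by positivity
    unfold density
    rw [hcard, le_div_iff₀ hpos, ← hedges]
    calc β * (((∑ v, ⌊w v * N⌋₊).choose 3 : ℕ) : ℝ)
        ≤ 6 * G.lagrangianFun (fun v => (⌊w v * N⌋₊ : ℝ) / N) *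
            (((∑ v, ⌊w v * N⌋₊).choose 3 : ℕ) : ℝ) := by gcongr
      _ ≤ 6 * G.lagrangianFun (fun v => (⌊w v * N⌋₊ : ℝ) / N) * (N ^ 3 / 6) := by gcongr
      _ = _ := by ring

end RGraph

/-! ### The cubic and its maximum -/

/-- With `a = 1 / s`, six times the limiting value of the Lagrangian function of `meetGraph s n`
when the first `s` vertices share the weight `X` evenly. -/
noncomputable def meetPoly (a X : ℝ) : ℝ := (1 + 2 * a ^ 2) * X ^ 3 - 3 * (1 + a) * X ^ 2 + 3 * X

/-- The maximizer of `meetPoly (1 / (2 * k))` on `[0, 1]`. -/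
noncomputable def meetArg (k : ℕ) : ℝ :=
  (2 * (k : ℝ) ^ 2 + k - k * Real.sqrt (4 * k - 1)) / (2 * (k : ℝ) ^ 2 + 1)

theorem sq_sqrt_four_mul_sub_one {k : ℕ} (hk : 2 ≤ k) :
    Real.sqrt (4 * k - 1) ^ 2 = 4 * (k : ℝ) - 1 := by
  have : (2 : ℝ) ≤ k := by exact_mod_cast hk
  exact Real.sq_sqrt (by linarith)

theorem meetPoly_meetArg {k : ℕ} (hk : 2 ≤ k) :
    meetPoly (1 / (2 * k)) (meetArg k) = alphaK k := by
  have hk' : (2 : ℝ) ≤ k := by exact_mod_cast hk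
  have hR := sq_sqrt_four_mul_sub_one hk
  unfold meetPoly meetArg alphaK
  set R := Real.sqrt (4 * (k : ℝ) - 1)
  have hD : (2 * (k : ℝ) ^ 2 + 1) ≠ 0 := by positivity
  have hR3 : R ^ 3 = (4 * (k : ℝ) - 1) * R := by rw [pow_succ, hR]
  field_simp
  ring_nf
  simp only [hR3]
  ring

theorem meetArg_pos {k : ℕ} (hk : 2 ≤ k) : 0 < meetArg k := by
  have hk' : (2 : ℝ) ≤ k := by exact_mod_cast hk
  have hR := sq_sqrt_four_mul_sub_one hk
  unfold meetArg
  set R := Real.sqrt (4 * (k : ℝ) - 1)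
  have : R < 2 * k := by nlinarith
  apply div_pos _ (by positivity)
  nlinarith

theorem meetArg_lt_one {k : ℕ} (hk : 2 ≤ k) : meetArg k < 1 := by
  have hk' : (2 : ℝ) ≤ k := by exact_mod_cast hk
  have hR := sq_sqrt_four_mul_sub_one hk
  have hR0 := Real.sqrt_nonneg (4 * (k : ℝ) - 1)
  unfold meetArg
  set R := Real.sqrt (4 * (k : ℝ) - 1)
  have : 1 < R := by nlinarith
  rw [div_lt_one (by positivity)]
  nlinarith

/-- `meetArg k` is the smaller root of the derivative, so the difference of values has the double
factor `(X - x)²`; the remaining linear factor is nonnegative for `X ≤ 1`. -/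
theorem meetPoly_le {k : ℕ} (hk : 2 ≤ k) {X : ℝ} (hX : X ≤ 1) :
    meetPoly (1 / (2 * k)) X ≤ alphaK k := by
  have hk' : (2 : ℝ) ≤ k := by exact_mod_cast hk
  have hR := sq_sqrt_four_mul_sub_one hk
  have hR0 := Real.sqrt_nonneg (4 * (k : ℝ) - 1)
  set a : ℝ := 1 / (2 * k) with ha
  have ha0 : 0 < a := by positivity
  have ha4 : a ≤ 1 / 4 := by
    rw [ha]; apply one_div_le_one_div_of_le <;> linarith
  set x := meetArg k with hx
  set ρ := Real.sqrt (4 * (k : ℝ) - 1) / (2 * k) with hρ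
  have hρ0 : 0 ≤ ρ := by positivity
  have hxa : (1 + 2 * a ^ 2) * x = 1 + a - ρ := by
    rw [hx, hρ, ha, meetArg]
    field_simp
  have hρ2 : ρ ^ 2 = 2 * a - a ^ 2 := by
    rw [hρ, div_pow, hR, ha]
    field_simp
    ring
  have hcrit : (1 + 2 * a ^ 2) * x ^ 2 = 2 * (1 + a) * x - 1 := by
    have h1 : (1 + 2 * a ^ 2) * ((1 + 2 * a ^ 2) * x ^ 2 - (2 * (1 + a) * x - 1)) = 0 := by
      have : (1 + 2 * a ^ 2) * ((1 + 2 * a ^ 2) * x ^ 2 - (2 * (1 + a) * x - 1)) =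
        ((1 + 2 * a ^ 2) * x) ^ 2 - 2 * (1 + a) * ((1 + 2 * a ^ 2) * x) + (1 + 2 * a ^ 2) := by
        ring
      rw [this, hxa]
      linear_combination hρ2
    have := (mul_eq_zero.mp h1).resolve_left (by positivity)
    linarith
  rw [← meetPoly_meetArg hk, ← sub_nonneg]
  have key : meetPoly a x - meetPoly a X =
      (X - x) ^ 2 * (3 * (1 + a) - (1 + 2 * a ^ 2) * X - 2 * ((1 + 2 * a ^ 2) * x)) := by
    unfold meetPoly
    linear_combination (3 * (x - X)) * hcrit
  rw [key, hxa]
  apply mul_nonneg (sq_nonneg _)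
  nlinarith

/-- Here `u`, `v` stand for the two heaviest weights outside the core: the middle term bounds the
gain from added triples, the last is part of the loss from squares. When `1 - X - u - v ≥ 0`,
replacing both by their mean `s` only helps, and leaves a net gain `6s²(1 - 2X - 2s)`, which is
positive only if `X < 1/2`; there it is too small to lift the cubic above its value at `1/2`. -/
theorem meetPoly_add_le {k : ℕ} (hk : 2 ≤ k) {X u v : ℝ} (hX0 : 0 ≤ X) (hX : X ≤ 1) (hu : 0 ≤ u)
    (hv : 0 ≤ v) :
    meetPoly (1 / (2 * k)) X + 6 * (u * v * (1 - X - u - v)) - 3 * X * (u ^ 2 + v ^ 2)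
      ≤ alphaK k := by
  have hk' : (2 : ℝ) ≤ k := by exact_mod_cast hk
  have hle := @meetPoly_le k hk
  set a : ℝ := 1 / (2 * k) with ha
  have ha0 : 0 < a := by positivity
  have ha4 : a ≤ 1 / 4 := by
    rw [ha]; apply one_div_le_one_div_of_le <;> linarith
  rcases le_total (1 - X - u - v) 0 with hneg | hpos
  · have := hle hX
    have h1 : u * v * (1 - X - u - v) ≤ 0 :=
      mul_nonpos_of_nonneg_of_nonpos (mul_nonneg hu hv) hneg
    have h2 : 0 ≤ X * (u ^ 2 + v ^ 2) := by positivity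
    linarith
  obtain ⟨s, hs⟩ : ∃ s, s = (u + v) / 2 := ⟨_, rfl⟩
  have hs0 : 0 ≤ s := by rw [hs]; positivity
  have huv : u * v ≤ s ^ 2 := by rw [hs]; nlinarith [sq_nonneg (u - v)]
  have huv2 : 2 * s ^ 2 ≤ u ^ 2 + v ^ 2 := by rw [hs]; nlinarith [sq_nonneg (u - v)]
  have h1 : u * v * (1 - X - u - v) ≤ s ^ 2 * (1 - X - u - v) :=
    mul_le_mul_of_nonneg_right huv hpos
  have h2 : X * (2 * s ^ 2) ≤ X * (u ^ 2 + v ^ 2) := mul_le_mul_of_nonneg_left huv2 hX0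
  have h3 : 1 - X - u - v = 1 - X - 2 * s := by rw [hs]; ring
  rw [h3] at h1 ⊢
  rw [h3] at hpos
  have h4 : s ^ 2 * (1 - X - 2 * s) - X * s ^ 2 = s ^ 2 * (1 - 2 * X - 2 * s) := by ring
  rcases le_total (1 / 2) X with hX2 | hX2
  · have := hle hX
    have h5 : s ^ 2 * (1 - 2 * X - 2 * s) ≤ 0 :=
      mul_nonpos_of_nonneg_of_nonpos (sq_nonneg _) (by linarith)
    linarith
  -- AM-GM on `s, s, Y - 2s` with `Y = 1 - 2X`: the difference is `(Y - 3s)²(Y + 6s)`.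
  · have h5 : 27 * (s ^ 2 * (1 - 2 * X - 2 * s)) ≤ (1 - 2 * X) ^ 3 := by
      have : 0 ≤ (1 - 2 * X - 3 * s) ^ 2 * (1 - 2 * X + 6 * s) :=
        mul_nonneg (sq_nonneg _) (by linarith)
      linarith
    have h6 := hle (X := 1 / 2) (by norm_num)
    have h7 : meetPoly a X + 2 / 9 * (1 - 2 * X) ^ 3 ≤ meetPoly a (1 / 2) := by
      have ha2 : a ^ 2 ≤ 1 / 16 := by nlinarith
      have : meetPoly a (1 / 2) - (meetPoly a X + 2 / 9 * (1 - 2 * X) ^ 3) =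
          (1 / 2 - X) * ((1 + 2 * a ^ 2) * (1 / 4 + X / 2 + X ^ 2) - 3 * (1 + a) * (1 / 2 + X) + 3
            - 4 / 9 * (1 - 2 * X) ^ 2) := by unfold meetPoly; ring
      have h8 : 0 ≤ (1 + 2 * a ^ 2) * (1 / 4 + X / 2 + X ^ 2) - 3 * (1 + a) * (1 / 2 + X) + 3
            - 4 / 9 * (1 - 2 * X) ^ 2 := by
        nlinarith [mul_nonneg hX0 (sub_nonneg.mpr hX2), mul_nonneg hX0 (sub_nonneg.mpr ha4),
          mul_nonneg (sq_nonneg a) hX0, mul_nonneg (sq_nonneg a) (sq_nonneg X)]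
      have := mul_nonneg (sub_nonneg.mpr hX2) h8
      linarith
    linarith

theorem alphaK_mem_Ico {k : ℕ} (hk : 2 ≤ k) : alphaK k ∈ Set.Ico (0 : ℝ) 1 := by
  have hk' : (2 : ℝ) ≤ k := by exact_mod_cast hk
  constructor
  · simpa [meetPoly] using meetPoly_le hk (X := 0) zero_le_one
  · rw [← meetPoly_meetArg hk]
    have h0 := meetArg_pos hk
    have h1 := meetArg_lt_one hk
    set a : ℝ := 1 / (2 * k) with ha
    have ha0 : 0 < a := by positivity
    have ha4 : a ≤ 1 / 4 := by
      rw [ha]; apply one_div_le_one_div_of_le <;> linarith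
    set x := meetArg k
    have h2 : 0 < (1 - x) ^ 3 := pow_pos (by linarith) 3
    -- `1 - meetPoly a x = (1 - x)³ + a x²(3 - 2ax)`.
    have h3 : 0 ≤ a * x ^ 2 * (3 - 2 * a * x) :=
      mul_nonneg (by positivity) (by nlinarith)
    unfold meetPoly
    linarith

theorem irrational_alphaK {k : ℕ} (hk : 2 ≤ k) : Irrational (alphaK k) := by
  have hR : Irrational (Real.sqrt (4 * k - 1)) := by
    have : (4 * (k : ℝ) - 1) = ((4 * k - 1 : ℕ) : ℝ) := by
      rw [Nat.cast_sub (by omega)]; push_cast; ring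
    rw [this, irrational_sqrt_natCast_iff]
    rintro ⟨r, hr⟩
    have h4 : (4 * k - 1) % 4 = 3 := by omega
    rw [hr, Nat.mul_mod] at h4
    have : r % 4 < 4 := Nat.mod_lt _ (by norm_num)
    interval_cases r % 4 <;> omega
  have hcoef : ((4 * k ^ 2 - k : ℤ) : ℚ) ≠ 0 := by
    have : (0 : ℤ) < 4 * k ^ 2 - k := by
      have : (2 : ℤ) ≤ k := by exact_mod_cast hk
      nlinarith
    exact_mod_cast this.ne'
  have hden : ((2 * k ^ 2 + 1) ^ 2 : ℚ) ≠ 0 := by positivity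
  have := ((hR.ratCast_mul hcoef).ratCast_add (2 * k - 6 * k ^ 3 + 4 * k ^ 4 : ℚ)).div_ratCast hden
  convert this using 1
  unfold alphaK
  push_cast
  ring

/-- At the fixed argument `meetArg k`, decreasing `a` from `1/(2k)` to `1/(2k+2)` already increases
the cubic. -/
theorem alphaK_lt_succ {k : ℕ} (hk : 2 ≤ k) : alphaK k < alphaK (k + 1) := by
  have hk' : (2 : ℝ) ≤ k := by exact_mod_cast hk
  refine lt_of_lt_of_le ?_ (meetPoly_le (by omega : 2 ≤ k + 1) (meetArg_lt_one hk).le)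
  rw [← meetPoly_meetArg hk]
  have h0 := meetArg_pos hk
  have h1 := meetArg_lt_one hk
  set a : ℝ := 1 / (2 * k) with ha
  set b : ℝ := 1 / (2 * (k + 1 : ℕ)) with hb
  have hb0 : 0 < b := by positivity
  have ha4 : a ≤ 1 / 4 := by
    rw [ha]; apply one_div_le_one_div_of_le <;> linarith
  have hba : b < a := by
    rw [ha, hb]; apply one_div_lt_one_div_of_lt (by positivity); push_cast; linarith
  set x := meetArg k
  have : 0 < x ^ 2 * ((a - b) * (3 - 2 * (a + b) * x)) := by
    refine mul_pos (by positivity) (mul_pos (by linarith) ?_)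
    nlinarith
  unfold meetPoly
  linarith

/-! ### Newton identities and sparse sets of triples -/

theorem sum_powersetCard_two {V : Type*} [DecidableEq V] (S : Finset V) (z : V → ℝ) :
    2 * ∑ e ∈ S.powersetCard 2, ∏ i ∈ e, z i = (∑ i ∈ S, z i) ^ 2 - ∑ i ∈ S, z i ^ 2 := by
  induction S using Finset.induction_on with
  | empty => simp [Finset.powersetCard_eq_empty.mpr (show (∅ : Finset V).card < 2 by simp)]
  | insert a S ha ih =>
    have hnot : ∀ e ∈ S.powersetCard 1, a ∉ e := fun e he h =>
      ha ((Finset.mem_powersetCard.mp he).1 h)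
    rw [Finset.powersetCard_succ_insert ha, Finset.sum_union, Finset.sum_image,
      Finset.sum_insert ha, Finset.sum_insert ha, mul_add, ih,
      Finset.sum_congr rfl fun e he => Finset.prod_insert (hnot e he), ← Finset.mul_sum]
    · have : ∑ e ∈ S.powersetCard 1, ∏ i ∈ e, z i = ∑ i ∈ S, z i := by
        simp [Finset.powersetCard_one]
      rw [this]
      ring
    · intro e he e' he' h
      rw [← Finset.erase_insert (hnot e he), h, Finset.erase_insert (hnot e' he')]
    · rw [Finset.disjoint_right]
      intro e he h
      obtain ⟨e', -, rfl⟩ := Finset.mem_image.mp he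
      exact ha ((Finset.mem_powersetCard.mp h).1 (Finset.mem_insert_self _ _))

theorem sum_powersetCard_three {V : Type*} [DecidableEq V] (S : Finset V) (z : V → ℝ) :
    6 * ∑ e ∈ S.powersetCard 3, ∏ i ∈ e, z i =
      (∑ i ∈ S, z i) ^ 3 - 3 * (∑ i ∈ S, z i) * ∑ i ∈ S, z i ^ 2 + 2 * ∑ i ∈ S, z i ^ 3 := by
  induction S using Finset.induction_on with
  | empty => simp [Finset.powersetCard_eq_empty.mpr (show (∅ : Finset V).card < 3 by simp)]
  | insert a S ha ih =>
    have hnot : ∀ e ∈ S.powersetCard 2, a ∉ e := fun e he h =>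
      ha ((Finset.mem_powersetCard.mp he).1 h)
    rw [Finset.powersetCard_succ_insert ha, Finset.sum_union, Finset.sum_image,
      Finset.sum_insert ha, Finset.sum_insert ha, Finset.sum_insert ha, mul_add, ih,
      Finset.sum_congr rfl fun e he => Finset.prod_insert (hnot e he), ← Finset.mul_sum]
    · linear_combination 3 * z a * sum_powersetCard_two S z
    · intro e he e' he' h
      rw [← Finset.erase_insert (hnot e he), h, Finset.erase_insert (hnot e' he')]
    · rw [Finset.disjoint_right]
      intro e he h
      obtain ⟨e', -, rfl⟩ := Finset.mem_image.mp he
      exact ha ((Finset.mem_powersetCard.mp h).1 (Finset.mem_insert_self _ _))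

/-- A set of triples is `m`-sparse if every set of at most `m`, but at least two, vertices spans
at least two edges less than it has vertices. -/
def SparseTriples {V : Type*} [DecidableEq V] (m : ℕ) (A : Finset (Finset V)) : Prop :=
  (∀ e ∈ A, e.card = 3) ∧
    ∀ S : Finset V, 2 ≤ S.card → S.card ≤ m → (A.filter (· ⊆ S)).card + 2 ≤ S.card

/-- Let `i`, `j` be the two heaviest vertices of `S`. Sparsity is Hall's condition for the sets `e \
{i, j}`, so the triples have distinct representatives `f e` outside `{i, j}`. The other two vertices
of `e` contribute at most `y i * y j`. -/
theorem SparseTriples.exists_sum_le {V : Type*} [DecidableEq V] {m : ℕ} {A : Finset (Finset V)}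
    (hA : SparseTriples m A) {y : V → ℝ} (hy : ∀ v, 0 ≤ y v) {S : Finset V} (hS : S.card ≤ m)
    (hS2 : 2 ≤ S.card) :
    ∃ i ∈ S, ∃ j ∈ S, i ≠ j ∧
      ∑ e ∈ A.filter (· ⊆ S), ∏ v ∈ e, y v ≤ y i * y j * (∑ v ∈ S, y v - y i - y j) := by
  obtain ⟨i, hi, hmax_i⟩ := S.exists_max_image y (Finset.card_pos.mp (by omega))
  obtain ⟨j, hj, hmax_j⟩ := (S.erase i).exists_max_image y
    (Finset.card_pos.mp (by rw [Finset.card_erase_of_mem hi]; omega))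
  obtain ⟨hji, hjS⟩ := Finset.mem_erase.mp hj
  refine ⟨i, hi, j, hjS, hji.symm, ?_⟩
  have hpair : ∀ u ∈ S, ∀ v ∈ S, u ≠ v → y u * y v ≤ y i * y j := by
    intro u hu v hv huv
    by_cases hui : u = i
    · subst hui
      exact mul_le_mul_of_nonneg_left (hmax_j v (Finset.mem_erase.mpr ⟨huv.symm, hv⟩)) (hy _)
    · rw [mul_comm (y i)]
      exact mul_le_mul (hmax_j u (Finset.mem_erase.mpr ⟨hui, hu⟩)) (hmax_i v hv) (hy _) (hy _)
  obtain ⟨f, hf, hfmem⟩ := (Finset.all_card_le_biUnion_card_iff_exists_injective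
    fun e : {e // e ∈ A.filter (· ⊆ S)} => (e.1.erase i).erase j).mp (by
      intro E
      rcases E.eq_empty_or_nonempty with rfl | ⟨e₀, he₀⟩
      · simp
      set T := E.biUnion fun e => e.1 with hT
      have hTS : T ⊆ S := Finset.biUnion_subset.mpr fun e _ => (Finset.mem_filter.mp e.2).2
      -- Sparsity speaks only of sets with at least two vertices; a nonempty family spans at least
      -- three.
      have hT3 : 3 ≤ T.card := by
        rw [← hA.1 e₀.1 (Finset.mem_filter.mp e₀.2).1]
        exact Finset.card_le_card (Finset.subset_biUnion_of_mem (fun e => e.1) he₀)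
      have h1 := hA.2 T (by omega) ((Finset.card_le_card hTS).trans hS)
      have h2 : E.card ≤ (A.filter (· ⊆ T)).card := by
        rw [← Finset.card_image_of_injective E Subtype.val_injective]
        refine Finset.card_le_card fun e he => ?_
        obtain ⟨e', he', rfl⟩ := Finset.mem_image.mp he
        exact Finset.mem_filter.mpr ⟨(Finset.mem_filter.mp e'.2).1,
          Finset.subset_biUnion_of_mem (fun e => e.1) he'⟩
      have h3 : (T.erase i).erase j = E.biUnion fun e => (e.1.erase i).erase j := by
        ext v
        simp only [hT, Finset.mem_erase, Finset.mem_biUnion]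
        constructor
        · rintro ⟨h1, h2, e, he, hv⟩
          exact ⟨e, he, h1, h2, hv⟩
        · rintro ⟨e, he, h1, h2, hv⟩
          exact ⟨h1, h2, e, he, hv⟩
      have h4 := Finset.pred_card_le_card_erase (s := T) (a := i)
      have h5 := Finset.pred_card_le_card_erase (s := T.erase i) (a := j)
      rw [← h3]
      omega)
  have hfe : ∀ e, f e ∈ e.1 ∧ f e ≠ i ∧ f e ≠ j ∧ f e ∈ S := fun e => by
    have := hfmem e
    simp only [Finset.mem_erase] at this
    exact ⟨this.2.2, this.2.1, this.1, (Finset.mem_filter.mp e.2).2 this.2.2⟩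
  have hterm : ∀ e : {e // e ∈ A.filter (· ⊆ S)}, ∏ v ∈ e.1, y v ≤ y i * y j * y (f e) := by
    intro e
    obtain ⟨heA, heS⟩ := Finset.mem_filter.mp e.2
    have hcard : (e.1.erase (f e)).card = 2 := by
      rw [Finset.card_erase_of_mem (hfe e).1, hA.1 _ heA]
    obtain ⟨u, v, huv, huv'⟩ := Finset.card_eq_two.mp hcard
    have hu : u ∈ S := heS (Finset.mem_of_mem_erase (huv' ▸ Finset.mem_insert_self u {v}))
    have hv : v ∈ S := heS (Finset.mem_of_mem_erase
      (huv' ▸ Finset.mem_insert_of_mem (Finset.mem_singleton_self v)))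
    rw [← Finset.prod_erase_mul _ _ (hfe e).1, huv', Finset.prod_pair huv]
    exact mul_le_mul_of_nonneg_right (hpair u hu v hv huv) (hy _)
  calc ∑ e ∈ A.filter (· ⊆ S), ∏ v ∈ e, y v
      = ∑ e : {e // e ∈ A.filter (· ⊆ S)}, ∏ v ∈ e.1, y v := (Finset.sum_coe_sort _ _).symm
    _ ≤ ∑ e : {e // e ∈ A.filter (· ⊆ S)}, y i * y j * y (f e) :=
      Finset.sum_le_sum fun e _ => hterm e
    _ = y i * y j * ∑ v ∈ Finset.univ.image f, y v := by
      rw [← Finset.mul_sum, Finset.sum_image fun _ _ _ _ h => hf h]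
    _ ≤ y i * y j * ∑ v ∈ (S.erase i).erase j, y v := by
      refine mul_le_mul_of_nonneg_left ?_ (mul_nonneg (hy _) (hy _))
      refine Finset.sum_le_sum_of_subset_of_nonneg ?_ fun v _ _ => hy v
      intro v hv
      obtain ⟨e, -, rfl⟩ := Finset.mem_image.mp hv
      simp only [Finset.mem_erase]
      exact ⟨(hfe e).2.2.1, (hfe e).2.1, (hfe e).2.2.2⟩
    _ = _ := by
      rw [← Finset.add_sum_erase S y hi, ← Finset.add_sum_erase (S.erase i) y hj]
      ring

/-! ### Upper bound on small supports -/

/-- The triples that meet `C`, together with the triples in `A`. -/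
def meetAddGraph {V : Type*} [Fintype V] [DecidableEq V] (C : Finset V) (A : Finset (Finset V))
    (hA : ∀ e ∈ A, e.card = 3) : RGraph 3 V where
  edges := (Finset.univ.powersetCard 3 \ Cᶜ.powersetCard 3) ∪ A
  card_edge := fun e he => by
    rcases Finset.mem_union.mp he with h | h
    · exact (Finset.mem_powersetCard.mp (Finset.mem_sdiff.mp h).1).2
    · exact hA e h

/-- Newton's identity for all triples minus the one for triples inside `Cᶜ`. The sum of squares over
`Cᶜ` is the loss that pays for `A`. -/
theorem lagrangianFun_meetAddGraph {V : Type*} [Fintype V] [DecidableEq V] {C : Finset V}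
    {A : Finset (Finset V)} (hA : ∀ e ∈ A, e.card = 3) (hAC : ∀ e ∈ A, e ⊆ Cᶜ) {z : V → ℝ}
    (hz : ∑ v, z v = 1) :
    6 * (meetAddGraph C A hA).lagrangianFun z =
      1 - (1 - ∑ v ∈ C, z v) ^ 3 - 3 * ∑ v ∈ C, z v ^ 2 + 2 * ∑ v ∈ C, z v ^ 3
        - 3 * (∑ v ∈ C, z v) * ∑ v ∈ Cᶜ, z v ^ 2 + 6 * ∑ e ∈ A, ∏ v ∈ e, z v := by
  have hdisj : Disjoint (Finset.univ.powersetCard 3 \ Cᶜ.powersetCard 3) A := by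
    rw [Finset.disjoint_right]
    intro e he h
    exact (Finset.mem_sdiff.mp h).2 (Finset.mem_powersetCard.mpr ⟨hAC e he, hA e he⟩)
  have h1 := sum_powersetCard_three Finset.univ z
  have h2 := sum_powersetCard_three Cᶜ z
  have h3 := Finset.sum_sdiff (f := fun e => ∏ v ∈ e, z v)
    (Finset.powersetCard_mono (n := 3) (Finset.subset_univ Cᶜ))
  have s1 := Finset.sum_add_sum_compl C z
  have s2 := Finset.sum_add_sum_compl C fun v => z v ^ 2
  have s3 := Finset.sum_add_sum_compl C fun v => z v ^ 3
  rw [hz] at h1 s1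
  rw [← s2, ← s3] at h1
  rw [eq_sub_of_add_eq' s1] at h2
  unfold RGraph.lagrangianFun meetAddGraph
  rw [Finset.sum_union hdisj]
  linear_combination 6 * h3 + h1 - h2

/-- Equal weights on the core are optimal: `-3z² + 2z³` lies below its tangent at the mean `μ`, the
gap being `(z - μ)²(3 - 4μ - 2z)`. Four core vertices give `4μ ≤ X`, hence `4μ + 2z ≤ 3`. -/
theorem core_sum_le {V : Type*} {C : Finset V} (hC : 4 ≤ C.card) {z : V → ℝ}
    (hz : ∀ v, 0 ≤ z v) (hX : ∑ v ∈ C, z v ≤ 1) :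
    -3 * ∑ v ∈ C, z v ^ 2 + 2 * ∑ v ∈ C, z v ^ 3 ≤
      -3 * (1 / (C.card : ℝ)) * (∑ v ∈ C, z v) ^ 2
        + 2 * (1 / (C.card : ℝ)) ^ 2 * (∑ v ∈ C, z v) ^ 3 := by
  set X := ∑ v ∈ C, z v with hXdef
  set s : ℝ := (C.card : ℝ) with hs
  have hs4 : (4 : ℝ) ≤ s := by rw [hs]; exact_mod_cast hC
  have hX0 : 0 ≤ X := Finset.sum_nonneg fun v _ => hz v
  obtain ⟨μ, hμ⟩ : ∃ μ, μ = X / s := ⟨_, rfl⟩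
  have hsμ : s * μ = X := by rw [hμ]; field_simp
  have hμ4 : 4 * μ ≤ X := by
    have : 0 ≤ μ := by rw [hμ]; positivity
    nlinarith
  have hpoint : ∀ v ∈ C, -3 * z v ^ 2 + 2 * z v ^ 3 ≤
      -3 * μ ^ 2 + 2 * μ ^ 3 + (6 * μ ^ 2 - 6 * μ) * (z v - μ) := by
    intro v hv
    have : z v ≤ X := Finset.single_le_sum (fun v _ => hz v) hv
    have h : 0 ≤ (z v - μ) ^ 2 * (3 - 4 * μ - 2 * z v) :=
      mul_nonneg (sq_nonneg _) (by linarith)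
    linarith
  have hsum := Finset.sum_le_sum hpoint
  simp only [Finset.sum_add_distrib, ← Finset.mul_sum, Finset.sum_sub_distrib, Finset.sum_const,
    nsmul_eq_mul] at hsum
  rw [← hXdef, ← hs, hsμ, sub_self, mul_zero, add_zero] at hsum
  refine hsum.trans (le_of_eq ?_)
  rw [hμ]
  field_simp

theorem lagrangianFun_meetAddGraph_le {k : ℕ} (hk : 2 ≤ k) {V : Type*} [Fintype V]
    [DecidableEq V] {C : Finset V} (hC : C.card = 2 * k) {m : ℕ} {A : Finset (Finset V)}
    (hA : SparseTriples m A) (hAC : ∀ e ∈ A, e ⊆ Cᶜ) {z : V → ℝ} (hz : z ∈ stdSimplex ℝ V)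
    {S : Finset V} (hS : S.card ≤ m) (hzS : ∀ v, v ∉ S → z v = 0) :
    6 * (meetAddGraph C A hA.1).lagrangianFun z ≤ alphaK k := by
  rw [lagrangianFun_meetAddGraph hA.1 hAC hz.2]
  have hX0 : 0 ≤ ∑ v ∈ C, z v := Finset.sum_nonneg fun v _ => hz.1 v
  have s1 := Finset.sum_add_sum_compl C z
  rw [hz.2] at s1
  have hY0 : 0 ≤ ∑ v ∈ Cᶜ, z v := Finset.sum_nonneg fun v _ => hz.1 v
  have hX1 : ∑ v ∈ C, z v ≤ 1 := by linarith
  have hcore := core_sum_le (by omega : 4 ≤ C.card) hz.1 hX1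
  rw [hC] at hcore
  push_cast at hcore
  have hAsum : ∑ e ∈ A, ∏ v ∈ e, z v = ∑ e ∈ A.filter (· ⊆ S \ C), ∏ v ∈ e, z v := by
    symm
    refine Finset.sum_subset (Finset.filter_subset _ _) fun e he hne => ?_
    have : ¬ e ⊆ S := fun h => hne (Finset.mem_filter.mpr ⟨he, fun v hv =>
      Finset.mem_sdiff.mpr ⟨h hv, Finset.mem_compl.mp (hAC e he hv)⟩⟩)
    obtain ⟨v, hv, hvS⟩ := Finset.not_subset.mp this
    exact Finset.prod_eq_zero hv (hzS v hvS)
  have hsub : S \ C ⊆ Cᶜ := fun v hv => Finset.mem_compl.mpr (Finset.mem_sdiff.mp hv).2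
  have hSC : (S \ C).card ≤ m := (Finset.card_le_card Finset.sdiff_subset).trans hS
  have hmain : ∃ u v : ℝ, 0 ≤ u ∧ 0 ≤ v ∧
      ∑ e ∈ A, ∏ v ∈ e, z v ≤ u * v * (1 - ∑ v ∈ C, z v - u - v) ∧
      u ^ 2 + v ^ 2 ≤ ∑ v ∈ Cᶜ, z v ^ 2 := by
    rw [hAsum]
    -- With fewer than two outside vertices in the support no added triple counts, and `u = v = 0`
    -- serves.
    rcases Nat.lt_or_ge (S \ C).card 2 with hlt | hge
    · refine ⟨0, 0, le_rfl, le_rfl, ?_, ?_⟩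
      · rw [Finset.filter_eq_empty_iff.mpr fun e he h => ?_]
        · simp
        · have := Finset.card_le_card h
          have := hA.1 e he
          omega
      · simpa using Finset.sum_nonneg fun v _ => sq_nonneg (z v)
    · obtain ⟨i, hi, j, hj, hij, hle⟩ := hA.exists_sum_le hz.1 hSC hge
      refine ⟨z i, z j, hz.1 i, hz.1 j, hle.trans ?_, ?_⟩
      · refine mul_le_mul_of_nonneg_left ?_ (mul_nonneg (hz.1 i) (hz.1 j))
        have : ∑ v ∈ S \ C, z v ≤ ∑ v ∈ Cᶜ, z v :=
          Finset.sum_le_sum_of_subset_of_nonneg hsub fun v _ _ => hz.1 v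
        linarith
      · rw [← Finset.sum_pair (f := fun v => z v ^ 2) hij]
        refine Finset.sum_le_sum_of_subset_of_nonneg ?_ fun v _ _ => sq_nonneg _
        intro v hv
        rcases Finset.mem_insert.mp hv with rfl | hv
        · exact hsub hi
        · rw [Finset.mem_singleton.mp hv]
          exact hsub hj
  obtain ⟨u, v, hu, hv, huv, huv2⟩ := hmain
  have := meetPoly_add_le hk hX0 hX1 hu hv
  have h2 := mul_le_mul_of_nonneg_left huv2 hX0
  unfold meetPoly at this
  linarith

/-! ### Evaluation at even weights -/

/-- The weights `X / |C|` on `C` and `(1 - X) / |Cᶜ|` off `C`. -/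
noncomputable def coreWeight {V : Type*} [Fintype V] [DecidableEq V] (C : Finset V) (X : ℝ) :
    V → ℝ := fun v => if v ∈ C then X / C.card else (1 - X) / Cᶜ.card

theorem sum_coreWeight_pow {V : Type*} [Fintype V] [DecidableEq V] (C : Finset V) (X : ℝ)
    (n : ℕ) : ∑ v ∈ C, coreWeight C X v ^ n = C.card * (X / C.card) ^ n := by
  rw [Finset.sum_congr rfl fun v hv => by rw [coreWeight, if_pos hv], Finset.sum_const,
    nsmul_eq_mul]

theorem sum_compl_coreWeight_pow {V : Type*} [Fintype V] [DecidableEq V] (C : Finset V) (X : ℝ)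
    (n : ℕ) : ∑ v ∈ Cᶜ, coreWeight C X v ^ n = Cᶜ.card * ((1 - X) / Cᶜ.card) ^ n := by
  rw [Finset.sum_congr rfl fun v hv => by rw [coreWeight, if_neg (Finset.mem_compl.mp hv)],
    Finset.sum_const, nsmul_eq_mul]

theorem coreWeight_mem_stdSimplex {V : Type*} [Fintype V] [DecidableEq V] {C : Finset V}
    (hC : 0 < C.card) (hC' : 0 < Cᶜ.card) {X : ℝ} (hX0 : 0 ≤ X) (hX1 : X ≤ 1) :
    coreWeight C X ∈ stdSimplex ℝ V := by
  constructor
  · intro v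
    unfold coreWeight
    have := sub_nonneg.mpr hX1
    split_ifs <;> positivity
  · have h1 := sum_coreWeight_pow C X 1
    have h2 := sum_compl_coreWeight_pow C X 1
    simp only [pow_one] at h1 h2
    rw [← Finset.sum_add_sum_compl C, h1, h2]
    field_simp
    ring

theorem lagrangianFun_coreWeight {V : Type*} [Fintype V] [DecidableEq V] {C : Finset V}
    (hC : 0 < C.card) (hC' : 0 < Cᶜ.card) {A : Finset (Finset V)} (hA : ∀ e ∈ A, e.card = 3)
    (hAC : ∀ e ∈ A, e ⊆ Cᶜ) {X : ℝ} (hX0 : 0 ≤ X) (hX1 : X ≤ 1) :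
    6 * (meetAddGraph C A hA).lagrangianFun (coreWeight C X) =
      meetPoly (1 / C.card) X - 3 * X * (1 - X) ^ 2 / Cᶜ.card
        + 6 * A.card * ((1 - X) / Cᶜ.card) ^ 3 := by
  have hAsum : ∑ e ∈ A, ∏ v ∈ e, coreWeight C X v = A.card * ((1 - X) / Cᶜ.card) ^ 3 := by
    rw [← nsmul_eq_mul, ← Finset.sum_const]
    refine Finset.sum_congr rfl fun e he => ?_
    rw [← hA e he]
    exact Finset.prod_eq_pow_card fun v hv => if_neg (Finset.mem_compl.mp (hAC e he hv))
  have h1 := sum_coreWeight_pow C X 1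
  simp only [pow_one] at h1
  rw [lagrangianFun_meetAddGraph hA hAC (coreWeight_mem_stdSimplex hC hC' hX0 hX1).2, hAsum, h1,
    sum_coreWeight_pow, sum_coreWeight_pow, sum_compl_coreWeight_pow]
  unfold meetPoly
  have hs : (C.card : ℝ) ≠ 0 := by positivity
  have ht : (Cᶜ.card : ℝ) ≠ 0 := by positivity
  field_simp
  ring

/-! ### Sparse triples by the deletion method -/

/-- Colour 0 plays the role of being chosen with probability `1 / q`; counting colourings replaces
expectation. -/
theorem card_colourings {ι : Type*} [Fintype ι] [DecidableEq ι] (q : ℕ) [NeZero q]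
    (F : Finset ι) :
    ((Finset.univ.filter fun ω : ι → Fin q => ∀ e ∈ F, ω e = 0).card : ℝ) =
      (q : ℝ) ^ Fintype.card ι * (1 / (q : ℝ)) ^ F.card := by
  have hq : (q : ℝ) ≠ 0 := Nat.cast_ne_zero.mpr (NeZero.ne q)
  have h : (Finset.univ.filter fun ω : ι → Fin q => ∀ e ∈ F, ω e = 0) =
      Fintype.piFinset fun e => if e ∈ F then {0} else Finset.univ := by
    ext ω
    simp only [Finset.mem_filter, Finset.mem_univ, true_and, Fintype.mem_piFinset]
    refine forall_congr' fun e => ?_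
    split_ifs with he <;> simp [he]
  have hprod : ∏ e : ι, (if e ∈ F then 1 / (q : ℝ) else 1) = (1 / (q : ℝ)) ^ F.card := by
    simp [Finset.prod_ite_mem]
  rw [h, Fintype.card_piFinset, ← hprod, ← Finset.card_univ, ← Finset.prod_const,
    ← Finset.prod_mul_distrib]
  push_cast
  refine Finset.prod_congr rfl fun e _ => ?_
  split_ifs <;> simp [hq]

/-- The deletion method: there is a subset of `T` that contains no member of `B` and is at least as
large as the expected number of elements minus the expected number of members of `B` in a random
subset of density `1 / q`. -/
theorem exists_subset_avoiding {ι : Type*} [Fintype ι] [DecidableEq ι] (T : Finset ι)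
    (B : Finset (Finset ι)) (hB : ∀ F ∈ B, F.Nonempty) (q : ℕ) [NeZero q] :
    ∃ A ⊆ T, (∀ F ∈ B, ¬ F ⊆ A) ∧
      (T.card : ℝ) / q - ∑ F ∈ B, (1 / (q : ℝ)) ^ F.card ≤ A.card := by
  let ind : Finset ι → (ι → Fin q) → ℝ := fun F ω => if ∀ e ∈ F, ω e = 0 then 1 else 0
  have hind : ∀ F, ∑ ω, ind F ω = (q : ℝ) ^ Fintype.card ι * (1 / (q : ℝ)) ^ F.card := fun F => by
    rw [← card_colourings, Finset.sum_boole]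
  have havg : ∑ _ω : ι → Fin q, ((T.card : ℝ) / q - ∑ F ∈ B, (1 / (q : ℝ)) ^ F.card) ≤
      ∑ ω : ι → Fin q, (∑ e ∈ T, ind {e} ω - ∑ F ∈ B, ind F ω) := by
    rw [Finset.sum_sub_distrib (f := fun ω => ∑ e ∈ T, ind {e} ω),
      Finset.sum_comm (t := T), Finset.sum_comm (t := B)]
    simp only [hind, ← Finset.mul_sum, Finset.sum_const, Finset.card_univ, Fintype.card_fun,
      Fintype.card_fin, nsmul_eq_mul, Finset.card_singleton, pow_one]
    push_cast
    apply le_of_eq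
    ring
  obtain ⟨ω, -, hω⟩ := Finset.exists_le_of_sum_le Finset.univ_nonempty havg
  set A₀ := T.filter fun e => ω e = 0 with hA₀
  have hT : ∑ e ∈ T, ind {e} ω = A₀.card := by simp [ind, hA₀]
  have hBsum : ((B.filter (· ⊆ A₀)).card : ℝ) ≤ ∑ F ∈ B, ind F ω := by
    simp only [ind, Finset.sum_boole]
    refine Nat.cast_le.mpr (Finset.card_le_card fun F hF => ?_)
    obtain ⟨h1, h2⟩ := Finset.mem_filter.mp hF
    exact Finset.mem_filter.mpr ⟨h1, fun e he => (Finset.mem_filter.mp (h2 he)).2⟩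
  choose c hc using hB
  -- One element is deleted from each forbidden set that survives in `A₀`.
  set D := (B.filter (· ⊆ A₀)).attach.image fun F => c F.1 (Finset.mem_filter.mp F.2).1 with hD
  have hDcard : D.card ≤ (B.filter (· ⊆ A₀)).card := Finset.card_image_le.trans (by simp)
  refine ⟨A₀ \ D, Finset.sdiff_subset.trans (Finset.filter_subset _ _), ?_, ?_⟩
  · intro F hF hFA
    have hmem : F ∈ B.filter (· ⊆ A₀) :=
      Finset.mem_filter.mpr ⟨hF, hFA.trans Finset.sdiff_subset⟩
    exact (Finset.mem_sdiff.mp (hFA (hc F hF))).2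
      (Finset.mem_image.mpr ⟨⟨F, hmem⟩, Finset.mem_attach _ _, rfl⟩)
  · have h1 : (A₀.card : ℝ) ≤ (A₀ \ D).card + D.card := by
      have := Finset.le_card_sdiff D A₀
      exact_mod_cast (by omega : A₀.card ≤ (A₀ \ D).card + D.card)
    have h2 : (D.card : ℝ) ≤ (B.filter (· ⊆ A₀)).card := by exact_mod_cast hDcard
    linarith

/-- Sets of `v` vertices that span `v - 1` triples, recorded by the triples. -/
def denseConfigs {V : Type*} [DecidableEq V] (m : ℕ) (U : Finset V) :
    Finset (Finset (Finset V)) :=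
  (Finset.Icc 3 m).biUnion fun v => (U.powersetCard v).biUnion fun S =>
    (S.powersetCard 3).powersetCard (v - 1)

/-- Triples inside `S` lie in `S ∩ U`; a violation there contains exactly `|S ∩ U| - 1` triples
forming a forbidden configuration. -/
theorem sparseTriples_of_avoids {V : Type*} [DecidableEq V] {m : ℕ} {U : Finset V}
    {A : Finset (Finset V)} (hA : A ⊆ U.powersetCard 3)
    (hav : ∀ F ∈ denseConfigs m U, ¬ F ⊆ A) : SparseTriples m A := by
  refine ⟨fun e he => (Finset.mem_powersetCard.mp (hA he)).2, fun S hS2 hSm => ?_⟩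
  have hfil : A.filter (· ⊆ S) = A.filter (· ⊆ S ∩ U) :=
    Finset.filter_congr fun e he => by
      simp [Finset.subset_inter_iff, (Finset.mem_powersetCard.mp (hA he)).1]
  have hle := Finset.card_le_card (Finset.inter_subset_left : S ∩ U ⊆ S)
  rw [hfil]
  rcases Nat.lt_or_ge (S ∩ U).card 3 with hlt | hge
  · rw [Finset.filter_eq_empty_iff.mpr fun e he h => ?_]
    · simpa using hS2
    · have := Finset.card_le_card h
      rw [(Finset.mem_powersetCard.mp (hA he)).2] at this
      omega
  · by_contra hcon
    obtain ⟨F, hF, hFcard⟩ := Finset.exists_subset_card_eq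
      (show (S ∩ U).card - 1 ≤ (A.filter (· ⊆ S ∩ U)).card by omega)
    refine hav F ?_ (hF.trans (Finset.filter_subset _ _))
    refine Finset.mem_biUnion.mpr ⟨(S ∩ U).card, Finset.mem_Icc.mpr ⟨hge, by omega⟩, ?_⟩
    refine Finset.mem_biUnion.mpr ⟨S ∩ U,
      Finset.mem_powersetCard.mpr ⟨Finset.inter_subset_right, rfl⟩, ?_⟩
    refine Finset.mem_powersetCard.mpr ⟨fun e he => ?_, hFcard⟩
    obtain ⟨h1, h2⟩ := Finset.mem_filter.mp (hF he)
    exact Finset.mem_powersetCard.mpr ⟨h2, (Finset.mem_powersetCard.mp (hA h1)).2⟩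

theorem sum_biUnion_le_sum_sum {ι κ : Type*} [DecidableEq κ] (s : Finset ι) (t : ι → Finset κ)
    {f : κ → ℝ} (hf : ∀ x, 0 ≤ f x) :
    ∑ x ∈ s.biUnion t, f x ≤ ∑ i ∈ s, ∑ x ∈ t i, f x := by
  classical
  induction s using Finset.induction_on with
  | empty => simp
  | insert a s ha ih =>
    rw [Finset.biUnion_insert, Finset.sum_insert ha]
    have := Finset.sum_union_inter (s₁ := t a) (s₂ := s.biUnion t) (f := f)
    have := Finset.sum_nonneg fun x (_ : x ∈ t a ∩ s.biUnion t) => hf x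
    linarith

/-- A configuration on `v` vertices costs `q^{-(v-1)}` against at most `|U|^v` vertex sets, so with
`|U| = Kq` the expected number is linear in `|U|`, while the expected number of triples is
quadratic. -/
theorem sum_denseConfigs_le {V : Type*} [DecidableEq V] (m : ℕ) (U : Finset V) {K q : ℕ}
    (hq : 0 < q) (hU : U.card = K * q) :
    ∑ F ∈ denseConfigs m U, (1 / (q : ℝ)) ^ F.card ≤
      U.card * ∑ v ∈ Finset.Icc 3 m, (((v.choose 3).choose (v - 1) * K ^ (v - 1) : ℕ) : ℝ) := by
  have hq' : (q : ℝ) ≠ 0 := by positivity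
  have hnn : ∀ F : Finset (Finset V), 0 ≤ (1 / (q : ℝ)) ^ F.card := fun F => by positivity
  refine (sum_biUnion_le_sum_sum _ _ hnn).trans ?_
  rw [Finset.mul_sum]
  refine Finset.sum_le_sum fun v hv => (sum_biUnion_le_sum_sum _ _ hnn).trans ?_
  have hv3 := (Finset.mem_Icc.mp hv).1
  have h1 : ∀ S ∈ U.powersetCard v, ∑ F ∈ (S.powersetCard 3).powersetCard (v - 1),
      (1 / (q : ℝ)) ^ F.card = ((v.choose 3).choose (v - 1) : ℕ) * (1 / (q : ℝ)) ^ (v - 1) := by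
    intro S hS
    rw [Finset.sum_congr rfl fun F hF => by rw [(Finset.mem_powersetCard.mp hF).2],
      Finset.sum_const, Finset.card_powersetCard, Finset.card_powersetCard,
      (Finset.mem_powersetCard.mp hS).2, nsmul_eq_mul]
  rw [Finset.sum_congr rfl h1, Finset.sum_const, Finset.card_powersetCard, nsmul_eq_mul]
  have h2 : ((U.card.choose v : ℕ) : ℝ) ≤ (U.card : ℝ) ^ v := by
    exact_mod_cast Nat.choose_le_pow _ _
  calc ((U.card.choose v : ℕ) : ℝ) *
        (((v.choose 3).choose (v - 1) : ℕ) * (1 / (q : ℝ)) ^ (v - 1))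
      ≤ (U.card : ℝ) ^ v * (((v.choose 3).choose (v - 1) : ℕ) * (1 / (q : ℝ)) ^ (v - 1)) := by
        gcongr
    _ = U.card * (((v.choose 3).choose (v - 1) : ℕ) * ((U.card : ℝ) * (1 / q)) ^ (v - 1)) := by
        obtain ⟨n, rfl⟩ : ∃ n, v = n + 1 := ⟨v - 1, by omega⟩
        rw [Nat.add_sub_cancel, pow_succ, mul_pow]
        ring
    _ = _ := by
        have : (U.card : ℝ) * (1 / q) = K := by rw [hU]; push_cast; field_simp
        rw [this]
        push_cast
        ring

theorem cast_choose_three (n : ℕ) :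
    ((n.choose 3 : ℕ) : ℝ) = (n : ℝ) * (n - 1) * (n - 2) / 6 := by
  induction n with
  | zero => simp
  | succ n ih =>
    rw [Nat.choose_succ_succ' n 2]
    push_cast
    rw [ih, Nat.cast_choose_two]
    ring

/-- Sparse sets of triples with quadratically many members. -/
theorem exists_sparseTriples (m σ n₀ : ℕ) :
    ∃ t : ℕ, n₀ ≤ t ∧ ∀ (V : Type) [Fintype V] [DecidableEq V] (U : Finset V), U.card = t →
      ∃ A : Finset (Finset V), SparseTriples m A ∧ (∀ e ∈ A, e ⊆ U) ∧
        (σ : ℝ) * (t : ℝ) ^ 2 ≤ A.card := by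
  -- As `t choose 3 ≥ t³/24` for `t ≥ 4`, density `1 / q` with `t = Kq` leaves `(σ + 1)t²` triples
  -- on average. Deletion costs at most `bt ≤ t²`; the choice of `q` ensures `t ≥ n₀, b, 4`.
  set K := 24 * (σ + 1) with hK
  set b := ∑ v ∈ Finset.Icc 3 m, ((v.choose 3).choose (v - 1) * K ^ (v - 1)) with hb
  set q := n₀ + b + 4 with hq
  have hqt : q ≤ K * q := Nat.le_mul_of_pos_left q (by omega)
  refine ⟨K * q, by omega, fun V _ _ U hU => ?_⟩
  have hq0 : 0 < q := by omega
  have : NeZero q := ⟨hq0.ne'⟩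
  obtain ⟨A, hAU, hav, hcard⟩ := exists_subset_avoiding (U.powersetCard 3) (denseConfigs m U)
    (by
      intro F hF
      obtain ⟨v, hv, hF⟩ := Finset.mem_biUnion.mp hF
      obtain ⟨S, -, hF⟩ := Finset.mem_biUnion.mp hF
      rw [← Finset.card_pos, (Finset.mem_powersetCard.mp hF).2]
      have := (Finset.mem_Icc.mp hv).1
      omega) q
  refine ⟨A, sparseTriples_of_avoids hAU hav,
    fun e he => (Finset.mem_powersetCard.mp (hAU he)).1, le_trans ?_ hcard⟩
  have hsum := sum_denseConfigs_le m U hq0 hU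
  rw [← Nat.cast_sum, ← hb] at hsum
  have hq' : (0 : ℝ) < q := by exact_mod_cast hq0
  set t : ℝ := ((K * q : ℕ) : ℝ) with ht
  have htq : t = K * q := by rw [ht]; push_cast; rfl
  have ht4 : (4 : ℝ) ≤ t := by rw [ht]; exact_mod_cast (by omega : 4 ≤ K * q)
  have htb : (b : ℝ) ≤ t := by rw [ht]; exact_mod_cast (by omega : b ≤ K * q)
  have hchoose : ((U.powersetCard 3).card : ℝ) = t * (t - 1) * (t - 2) / 6 := by
    rw [Finset.card_powersetCard, hU, cast_choose_three]
  have h1 : (σ + 1) * t ^ 2 ≤ ((U.powersetCard 3).card : ℝ) / q := by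
    rw [hchoose, le_div_iff₀ hq']
    have : (σ + 1) * t ^ 2 * q = t ^ 3 / 24 := by
      rw [htq, hK]; push_cast; ring
    rw [this]
    nlinarith [mul_nonneg (by linarith : 0 ≤ t) (mul_nonneg (by linarith : 0 ≤ t)
      (by linarith : 0 ≤ t - 4))]
  rw [hU] at hsum
  nlinarith

/-! ### The limit of the Lagrangians and the non-jump -/

theorem card_filter_val_lt {s n : ℕ} (h : s ≤ n) :
    (Finset.univ.filter fun i : Fin n => i.val < s).card = s := by
  rw [Fin.card_filter_val_lt, min_eq_right h]

theorem card_compl_filter_val_lt {s n : ℕ} (h : s ≤ n) :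
    ((Finset.univ.filter fun i : Fin n => i.val < s)ᶜ).card = n - s := by
  rw [Finset.card_compl, card_filter_val_lt h, Fintype.card_fin]

theorem meetGraph_eq (s n : ℕ) :
    meetGraph s n = meetAddGraph (Finset.univ.filter fun i : Fin n => i.val < s) ∅ (by simp) := by
  unfold meetGraph meetAddGraph
  congr 1
  ext e
  simp only [Finset.mem_filter, Finset.union_empty,
    Finset.mem_sdiff, Finset.mem_powersetCard, not_and]
  refine and_congr_right fun h => ⟨?_, fun h' => ?_⟩
  · rintro ⟨i, hi, his⟩ h'
    exact absurd (Finset.mem_filter.mpr ⟨Finset.mem_univ i, his⟩) (Finset.mem_compl.mp (h' hi))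
  · by_contra! hcon
    refine h' (fun i hi => Finset.mem_compl.mpr fun his => ?_) h.2
    exact absurd (Finset.mem_filter.mp his).2 (not_lt.mpr (hcon i hi))

theorem tendsto_lagrangian_meetGraph {k : ℕ} (hk : 2 ≤ k) :
    Filter.Tendsto (fun n : ℕ => 6 * (meetGraph (2 * k) n).lagrangian) Filter.atTop
      (nhds (alphaK k)) := by
  have hX0 := (meetArg_pos hk).le
  have hX1 := (meetArg_lt_one hk).le
  have hlim : Filter.Tendsto (fun n : ℕ => alphaK k -
      3 * meetArg k * (1 - meetArg k) ^ 2 / ((n - 2 * k : ℕ) : ℝ)) Filter.atTop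
      (nhds (alphaK k)) := by
    have h := ((tendsto_const_div_atTop_nhds_zero_nat (3 * meetArg k * (1 - meetArg k) ^ 2)).comp
      (Filter.tendsto_sub_atTop_nat (2 * k))).const_sub (alphaK k)
    simpa using h
  refine tendsto_of_tendsto_of_tendsto_of_le_of_le' hlim tendsto_const_nhds ?_ ?_
  all_goals
    filter_upwards [Filter.eventually_gt_atTop (2 * k)] with n hn
    have : Nonempty (Fin n) := ⟨⟨0, by omega⟩⟩
    have hgreat := RGraph.isGreatest_lagrangian (meetGraph (2 * k) n)
    have hC := card_filter_val_lt hn.le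
    have hC' := card_compl_filter_val_lt hn.le
  · have hle := hgreat.2 ⟨_, coreWeight_mem_stdSimplex
      (by rw [hC]; omega) (by rw [hC']; omega) hX0 hX1, rfl⟩
    rw [meetGraph_eq] at hle ⊢
    have hval := lagrangianFun_coreWeight (by rw [hC]; omega) (by rw [hC']; omega)
      (A := ∅) (by simp) (by simp) hX0 hX1
    rw [hC, hC'] at hval
    push_cast at hval
    rw [meetPoly_meetArg hk, Finset.card_empty, Nat.cast_zero] at hval
    linarith
  · obtain ⟨z, hz, hzeq⟩ := hgreat.1
    rw [← hzeq, meetGraph_eq]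
    -- The empty set of triples is sparse for every `m`, so `m = n` puts no restriction on the
    -- support.
    refine lagrangianFun_meetAddGraph_le hk hC (m := n) (A := ∅) ⟨by simp, ?_⟩ (by simp) hz
      (S := Finset.univ) (by simp) (by simp)
    intro S hS _
    simpa using hS

theorem exists_meetAddGraph_lt {k : ℕ} (hk : 2 ≤ k) (m : ℕ) :
    ∃ (n : ℕ) (C : Finset (Fin n)) (A : Finset (Finset (Fin n))) (hA : SparseTriples m A),
      C.card = 2 * k ∧ (∀ e ∈ A, e ⊆ Cᶜ) ∧
      ∃ w ∈ stdSimplex ℝ (Fin n), alphaK k < 6 * (meetAddGraph C A hA.1).lagrangianFun w := by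
  have hX0 := meetArg_pos hk
  have hX1 := meetArg_lt_one hk
  -- Then `6σ(1 - X) > 6 > 3X`, so the gain `6σ(1 - X)³/t` beats the deficit `3X(1 - X)²/t` whatever
  -- `t` is.
  obtain ⟨σ, hσ⟩ := exists_nat_gt (1 / (1 - meetArg k))
  obtain ⟨t, ht1, ht⟩ := exists_sparseTriples m σ 1
  have hC := card_filter_val_lt (Nat.le_add_right (2 * k) t)
  have hC' := card_compl_filter_val_lt (Nat.le_add_right (2 * k) t)
  rw [Nat.add_sub_cancel_left] at hC'
  obtain ⟨A, hA, hAC, hAcard⟩ := ht _ _ hC'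
  refine ⟨_, _, A, hA, hC, hAC, _, coreWeight_mem_stdSimplex (by rw [hC]; omega)
    (by rw [hC']; omega) hX0.le hX1.le, ?_⟩
  rw [lagrangianFun_coreWeight (by rw [hC]; omega) (by rw [hC']; omega) hA.1 hAC hX0.le hX1.le,
    hC, hC']
  push_cast
  rw [meetPoly_meetArg hk]
  set X := meetArg k
  have ht0 : (0 : ℝ) < t := by exact_mod_cast ht1
  have hY : 0 < 1 - X := by linarith
  rw [div_lt_iff₀ hY] at hσ
  have h1 : 6 * (σ * (t : ℝ) ^ 2) * ((1 - X) / t) ^ 3 ≤ 6 * A.card * ((1 - X) / t) ^ 3 := by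
    gcongr
  have h2 : 6 * (σ * (t : ℝ) ^ 2) * ((1 - X) / t) ^ 3 =
      6 * (σ * (1 - X)) * (1 - X) ^ 2 / t := by
    field_simp
  have h3 : 3 * X * (1 - X) ^ 2 / t < 6 * (σ * (1 - X)) * (1 - X) ^ 2 / t := by
    gcongr ?_ * _ / _
    linarith
  linarith

theorem not_isJump_alphaK {k : ℕ} (hk : 2 ≤ k) : ¬ IsJump 3 (alphaK k) := by
  rintro ⟨c, hc, hjump⟩
  have hα := (alphaK_mem_Ico hk).1
  set α := alphaK k with hαdef
  -- Chosen so that `(α + c)(m - 1)(m - 2) > α m²`. Since `m` depends only on `α` and `c`, the graph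
  -- may depend on `m`, and `ε = β - α` on the graph.
  obtain ⟨m, hm⟩ := exists_nat_gt (max 3 (3 * (α + c) / c))
  have hm3 : (3 : ℝ) < m := (le_max_left _ _).trans_lt hm
  have hmc : 3 * (α + c) < m * c := (div_lt_iff₀ hc).mp ((le_max_right _ _).trans_lt hm)
  have hm3' : 3 < m := by exact_mod_cast hm3
  obtain ⟨n, C, A, hA, hC, hAC, w, hw, hwα⟩ := exists_meetAddGraph_lt hk m
  obtain ⟨β, hβα, hβ⟩ := exists_between hwα
  obtain ⟨n₀, hn₀⟩ := hjump (β - α) (sub_pos.mpr hβα) m hm3'.le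
  obtain ⟨W, _, π, hW, hdens⟩ := RGraph.exists_pullback_density _ hw hβ n₀
  obtain ⟨H, hH, hHd⟩ := hn₀ W _ hW (by linarith)
  obtain ⟨z, hz, S, hS, hzS, hle⟩ :=
    RGraph.exists_weight_of_contains_pullback _ π (by omega) H hH
  have hup := lagrangianFun_meetAddGraph_le hk hC hA hAC hz hS hzS
  rw [← hαdef] at hup
  have hpos : (0 : ℝ) < (m.choose 3 : ℕ) := by exact_mod_cast Nat.choose_pos hm3'.le
  unfold RGraph.density at hHd
  rw [Fintype.card_fin, le_div_iff₀ hpos, cast_choose_three] at hHd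
  have h1 : (m : ℝ) ^ 3 * (6 * (meetAddGraph C A hA.1).lagrangianFun z) ≤ m ^ 3 * α := by gcongr
  have h2 : (α + c) * (m * (m - 1) * (m - 2)) ≤ m ^ 3 * α := by linarith
  have h3 : 0 < (m : ℝ) ^ 2 * (m * c - 3 * (α + c)) :=
    mul_pos (by positivity) (by linarith)
  have h4 : 0 < (m : ℝ) * (α + c) := mul_pos (by linarith) (by linarith)
  linarith

theorem theorem1p4 :
    (∀ k : ℕ, 2 ≤ k →
      alphaK k ∈ Set.Ico (0 : ℝ) 1 ∧
      ¬ IsJump 3 (alphaK k) ∧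
      Irrational (alphaK k) ∧
      Filter.Tendsto (fun n : ℕ => 6 * (meetGraph (2 * k) n).lagrangian) Filter.atTop
        (nhds (alphaK k))) ∧
    {α : ℝ | α ∈ Set.Ico (0 : ℝ) 1 ∧ ¬ IsJump 3 α ∧ Irrational α}.Infinite := by
  refine ⟨fun k hk => ⟨alphaK_mem_Ico hk, not_isJump_alphaK hk, irrational_alphaK hk,
    tendsto_lagrangian_meetGraph hk⟩, ?_⟩
  have hmono : StrictMono fun k : ℕ => alphaK (k + 2) :=
    strictMono_nat_of_lt_succ fun k => alphaK_lt_succ (by omega)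
  exact Set.infinite_of_injective_forall_mem hmono.injective fun k =>
    ⟨alphaK_mem_Ico (by omega), not_isJump_alphaK (by omega), irrational_alphaK (by omega)⟩
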